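/- Theorem 1. A zero-one matrix $M$ contains a zero-one matrix $A$ if one can delete some rows and columns of $M$ and turn some $1$-entries into $0$-entries so that the resulting matrix is $A$. Let $\mathrm{ex}(n,A)$ denote the maximum number of $1$-entries in an $n\times n$ zero-one matrix that does not contain $A$ (and let it be $0$ if every $n\times n$ zero-one matrix contains $A$). A zero-one matrix $A$ is column-$t$-partite if its columns can be cut into $t$ (possibly empty) blocks of consecutive columns such that each row of each block contains at most one $1$-entry. Let $t\ge 2$ be an integer and let $A$ be a column-$t$-partite zero-one matrix. Then $$\mathrm{ex}(n,A)<n^{2-\frac1t+\frac1{2t^2}+o(1)}\qquad\text{for all } n\ge 2,$$ where $o(1)$ denotes a quantity depending on $t$, $A$ and $n$ that, for fixed $t$ and $A$, tends to $0$ as $n\to\infty$. -/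

import Mathlib

open Filter Topology

/-- A zero-one matrix with `m` rows and `n` columns. -/
abbrev ZeroOneMatrix (m n : ℕ) := Matrix (Fin m) (Fin n) (Fin 2)

namespace ZeroOneMatrix

/-- `M` contains `A`: after deleting rows and columns of `M` (the surviving ones, listed in
increasing order, are given by `f` and `g`), one can turn some `1`-entries into `0`-entries so as
to obtain `A`. -/
def Contains {m n r s : ℕ} (M : ZeroOneMatrix m n) (A : ZeroOneMatrix r s) : Prop :=
  ∃ (f : Fin r ↪o Fin m) (g : Fin s ↪o Fin n),
    ∀ i j, A i j = 1 → M (f i) (g j) = 1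

/-- The weight of `M`, i.e. the number of its `1`-entries. -/
def weight {m n : ℕ} (M : ZeroOneMatrix m n) : ℕ :=
  (Finset.univ.filter fun p : Fin m × Fin n => M p.1 p.2 = 1).card

open Classical in
/-- The extremal number of `A`: the maximum weight of an `n × n` zero-one matrix that does not
contain `A` (it is `0` if every `n × n` matrix contains `A`). -/
noncomputable def ex {r s : ℕ} (n : ℕ) (A : ZeroOneMatrix r s) : ℕ :=
  (Finset.univ.filter fun M : ZeroOneMatrix n n => ¬ M.Contains A).sup weight

/-- `A` is column-`t`-partite: the columns can be cut into `t` blocks of consecutive columns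
(the monotone function `c` gives the block of each column; blocks may be empty) such that each
row of each block has at most one `1`-entry. -/
def IsColumnPartite {r s : ℕ} (t : ℕ) (A : ZeroOneMatrix r s) : Prop :=
  ∃ c : Fin s → Fin t, Monotone c ∧
    ∀ (i : Fin r) (j j' : Fin s), c j = c j' → A i j = 1 → A i j' = 1 → j = j'

end ZeroOneMatrix

/-! Let Φ_q(R) (`starMoment`) count the pairs of a q-tuple of rows in R and a t-tuple of columns
that meet only in 1-entries. Two power means turn a weight above the claimed bound into a lower
bound of about n^(t + 1/2) for Φ_t of all rows. The rows are cut into nested blocks of L^i rows,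
with L a large constant and n about L^N, and one descends through the blocks.

Suppose Φ_q(R) is at least K |R|^q and no sub-block of R carries a share L^-(1+δ) of it. Then most
of Φ_q(R) comes from column tuples with common rows in at least r sub-blocks. Colour each tuple by
its set of sub-blocks. Some q-tuple of rows has a large common neighbourhood in which a popular
colour is dense, and Erdős's box theorem gives t column sets all of whose transversals have that
colour. Once these sets are separated they yield A: a row of A uses at most one column per set, so
every sub-block of the colour supplies it (`contains_of_box`).

Hence, if A is avoided, some sub-block keeps a share L^-(1+δ) at each level, as long as Φ_q(R) ≥ K
|R|^q. For a fixed q this condition is available for blocks below a threshold size only, and the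
threshold decreases with q. The descent starts with q = t and passes to q + 1 by power means when
the next threshold is crossed. The loss t/(2q) in `momentExponent` is chosen so that the size at
which Φ_(q+1) becomes usable is the size at which the power mean yields the required bound. A single
row with q = Q large would then have moment above L^(Nt) ≥ n^t, which is impossible. -/

namespace ZeroOneMatrix

/-! ### Erdős's box theorem. -/

section Box

variable {β : Type} [DecidableEq β]

/-- The first coordinates by which `T` extends to an element of `E`. -/
def extensions {t : ℕ} (N : Finset β) (E : Finset (Fin (t + 1) → β)) (T : Fin t → β) :
    Finset β :=
  N.filter fun v => Fin.cons v T ∈ E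

lemma sum_card_extensions {t : ℕ} {N : Finset β} {E : Finset (Fin (t + 1) → β)}
    (hE : E ⊆ Fintype.piFinset fun _ => N) :
    E.card ≤ ∑ T ∈ Fintype.piFinset (fun _ : Fin t => N), (extensions N E T).card := by
  have hmaps : ∀ x ∈ E, (Fin.tail x : Fin t → β) ∈ Fintype.piFinset (fun _ : Fin t => N) := by
    intro x hx
    rw [Fintype.mem_piFinset]
    exact fun a => Fintype.mem_piFinset.1 (hE hx) a.succ
  rw [Finset.card_eq_sum_card_fiberwise hmaps]
  refine Finset.sum_le_sum fun T _ => ?_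
  refine Finset.card_le_card_of_injOn (fun x => x 0) ?_ ?_
  · intro x hx
    simp only [Finset.coe_filter, Set.mem_ofPred_eq] at hx
    simp only [extensions, Finset.coe_filter, Set.mem_ofPred_eq]
    refine ⟨Fintype.mem_piFinset.1 (hE hx.1) 0, ?_⟩
    rw [← hx.2, Fin.cons_self_tail]
    exact hx.1
  · intro x hx y hy hxy
    simp only [Finset.coe_filter, Set.mem_ofPred_eq] at hx hy
    rw [← Fin.cons_self_tail x, ← Fin.cons_self_tail y, hx.2, hy.2]
    simp only at hxy
    rw [hxy]

/-- Many `(k+1)`-sets of first coordinates extend a dense set of tuples simultaneously. -/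
lemma exists_dense_common_extension {t k : ℕ} {c : ℝ} (hc : 0 < c) {N : Finset β}
    {E : Finset (Fin (t + 1) → β)} (hN : 0 < N.card) (hkN : 2 * (k + 1 : ℝ) ≤ c * N.card)
    (hE : E ⊆ Fintype.piFinset fun _ => N) (hcard : c * (N.card : ℝ) ^ (t + 1) ≤ E.card) :
    ∃ V ∈ N.powersetCard (k + 1), (c / 2) ^ (k + 1) * (N.card : ℝ) ^ t ≤
      ((Fintype.piFinset fun _ : Fin t => N).filter fun T => V ⊆ extensions N E T).card := by
  by_contra! hcon
  set P := Fintype.piFinset fun _ : Fin t => N with hP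
  have hPc : (P.card : ℝ) = (N.card : ℝ) ^ t := by
    rw [hP, Fintype.card_piFinset_const]; push_cast; rfl
  set n : ℝ := (N.card : ℝ) with hn
  have hn0 : 0 < n := by simpa [hn] using hN
  have hdc : ∑ V ∈ N.powersetCard (k + 1), (P.filter fun T => V ⊆ extensions N E T).card
      = ∑ T ∈ P, ((extensions N E T).card).choose (k + 1) := by
    have := Finset.sum_card_bipartiteAbove_eq_sum_card_bipartiteBelow
      (s := N.powersetCard (k + 1)) (t := P) (fun V T => V ⊆ extensions N E T)
    refine this.trans (Finset.sum_congr rfl fun T _ => ?_)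
    rw [← Finset.card_powersetCard]
    congr 1
    ext V
    simp only [Finset.mem_bipartiteBelow, Finset.mem_powersetCard]
    constructor
    · rintro ⟨⟨_, h2⟩, h3⟩; exact ⟨h3, h2⟩
    · rintro ⟨h1, h2⟩; exact ⟨⟨h1.trans (Finset.filter_subset _ _), h2⟩, h1⟩
  -- Needed for a strict sum. Since E lies in a box of size |N|^(t+1), c ≤ 1, so `hkN` leaves room
  -- for k + 1 elements.
  have hpos : N.powersetCard (k + 1) |>.Nonempty := by
    rw [Finset.powersetCard_nonempty]
    by_contra! hlt
    have hE1 : (E.card : ℝ) ≤ n ^ (t + 1) := by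
      have := Finset.card_le_card hE
      rw [Fintype.card_piFinset_const] at this
      rw [hn]
      exact_mod_cast this
    have hc1 : c ≤ 1 := by
      have h := hcard.trans hE1
      have hp : 0 < n ^ (t + 1) := by positivity
      nlinarith
    have : n < k + 1 := by rw [hn]; exact_mod_cast hlt
    nlinarith
  have hlt : (∑ V ∈ N.powersetCard (k + 1),
      ((P.filter fun T => V ⊆ extensions N E T).card : ℝ))
      < (N.card.choose (k + 1)) * ((c / 2) ^ (k + 1) * n ^ t) := by
    refine (Finset.sum_lt_sum_of_nonempty hpos hcon).trans_le ?_
    rw [Finset.sum_const, Finset.card_powersetCard, nsmul_eq_mul]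
  have hdc' : (∑ V ∈ N.powersetCard (k + 1),
      ((P.filter fun T => V ⊆ extensions N E T).card : ℝ))
      = ∑ T ∈ P, (((extensions N E T).card).choose (k + 1) : ℝ) := by exact_mod_cast hdc
  rw [hdc'] at hlt
  have hfac : (0 : ℝ) < (k + 1).factorial := by exact_mod_cast Nat.factorial_pos _
  have hlow : ∑ T ∈ P, (((extensions N E T).card + 1 - (k + 1) : ℕ) : ℝ) ^ (k + 1)
      / (k + 1).factorial ≤ ∑ T ∈ P, (((extensions N E T).card).choose (k + 1) : ℝ) :=
    Finset.sum_le_sum fun T _ => Nat.pow_le_choose _ _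
  rw [← Finset.sum_div] at hlow
  have hhigh : (N.card.choose (k + 1) : ℝ) ≤ n ^ (k + 1) / (k + 1).factorial :=
    Nat.choose_le_pow_div _ _
  -- Convexity is applied to powers of the extension numbers lowered by k (truncated at 0), which
  -- bound the binomials from below. By `hkN` this costs at most half of the sum, hence c / 2.
  have hsum : c / 2 * n ^ (t + 1) ≤
      ∑ T ∈ P, (((extensions N E T).card + 1 - (k + 1) : ℕ) : ℝ) := by
    have h1 : (E.card : ℝ) ≤ ∑ T ∈ P, ((extensions N E T).card : ℝ) := by
      exact_mod_cast sum_card_extensions hE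
    have h2 : ∑ T ∈ P, ((extensions N E T).card : ℝ) - P.card * (k + 1 : ℝ) ≤
        ∑ T ∈ P, (((extensions N E T).card + 1 - (k + 1) : ℕ) : ℝ) := by
      rw [← nsmul_eq_mul, ← Finset.sum_const, ← Finset.sum_sub_distrib]
      refine Finset.sum_le_sum fun T _ => ?_
      have : (extensions N E T).card ≤ ((extensions N E T).card + 1 - (k + 1)) + (k + 1) := by
        omega
      rw [sub_le_iff_le_add]
      exact_mod_cast this
    rw [hPc] at h2
    have h3 : n ^ t * (2 * (k + 1 : ℝ)) ≤ n ^ t * (c * n) := by gcongr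
    have h4 : n ^ (t + 1) = n ^ t * n := pow_succ _ _
    rw [h4] at hcard ⊢
    nlinarith
  have hpm := pow_sum_le_card_mul_sum_pow (s := P)
    (f := fun T => (((extensions N E T).card + 1 - (k + 1) : ℕ) : ℝ))
    (fun _ _ => Nat.cast_nonneg _) k
  rw [hPc] at hpm
  have hpm2 : (c / 2 * n ^ (t + 1)) ^ (k + 1) ≤ (n ^ t) ^ k *
      ∑ T ∈ P, (((extensions N E T).card + 1 - (k + 1) : ℕ) : ℝ) ^ (k + 1) :=
    (pow_le_pow_left₀ (by positivity) hsum _).trans hpm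
  have hid : (c / 2 * n ^ (t + 1)) ^ (k + 1)
      = (n ^ t) ^ k * (n ^ (k + 1) * ((c / 2) ^ (k + 1) * n ^ t)) := by ring
  rw [hid] at hpm2
  have hfin := le_of_mul_le_mul_left hpm2 (by positivity)
  have h5 : (n ^ (k + 1) * ((c / 2) ^ (k + 1) * n ^ t)) / (k + 1).factorial <
      (n ^ (k + 1) * ((c / 2) ^ (k + 1) * n ^ t)) / (k + 1).factorial := by
    calc _ ≤ (∑ T ∈ P, (((extensions N E T).card + 1 - (k + 1) : ℕ) : ℝ) ^ (k + 1))
          / (k + 1).factorial := by gcongr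
      _ ≤ _ := hlow
      _ < _ := hlt
      _ ≤ n ^ (k + 1) / (k + 1).factorial * ((c / 2) ^ (k + 1) * n ^ t) := by gcongr
      _ = _ := by ring
  exact lt_irrefl _ h5

/-- **Erdős's box theorem**: a dense set of `t`-tuples contains a large combinatorial box. -/
theorem exists_box (k : ℕ) : ∀ (t : ℕ) (c : ℝ), 0 < c → ∃ n₀ : ℕ, ∀ (β : Type) [DecidableEq β]
    (N : Finset β) (E : Finset (Fin t → β)), n₀ ≤ N.card →
    E ⊆ Fintype.piFinset (fun _ => N) → c * (N.card : ℝ) ^ t ≤ E.card →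
    ∃ V : Fin t → Finset β, (∀ b, (V b).card = k + 1) ∧ ∀ T, (∀ b, T b ∈ V b) → T ∈ E
  | 0, c, hc => ⟨0, fun β _ N E _ _ hcard => by
      have hpos : 0 < E.card := by
        have : (0 : ℝ) < E.card := lt_of_lt_of_le (by simpa using hc) hcard
        exact_mod_cast this
      obtain ⟨x, hx⟩ := Finset.card_pos.1 hpos
      exact ⟨fun b => b.elim0, fun b => b.elim0, fun T _ => by rwa [Subsingleton.elim T x]⟩⟩
  | t + 1, c, hc => by
      obtain ⟨n₁, hn₁⟩ := exists_box k t ((c / 2) ^ (k + 1)) (by positivity)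
      obtain ⟨n₂, hn₂⟩ := exists_nat_ge (2 * (k + 1 : ℝ) / c)
      refine ⟨max n₁ (max n₂ 1), fun β _ N E hN hE hcard => ?_⟩
      simp only [max_le_iff] at hN
      have hkN : 2 * (k + 1 : ℝ) ≤ c * N.card := by
        rw [div_le_iff₀' hc] at hn₂
        refine hn₂.trans ?_
        have : (n₂ : ℝ) ≤ N.card := by exact_mod_cast hN.2.1
        gcongr
      obtain ⟨V, hV, hVc⟩ := exists_dense_common_extension hc hN.2.2 hkN hE hcard
      rw [Finset.mem_powersetCard] at hV
      obtain ⟨W, hWc, hW⟩ := hn₁ β N _ hN.1 (Finset.filter_subset _ _) hVc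
      refine ⟨Fin.cons V W, fun b => ?_, fun T hT => ?_⟩
      · refine Fin.cases ?_ (fun b => ?_) b
        · simpa using hV.2
        · simpa using hWc b
      · have h0 : T 0 ∈ V := by simpa using hT 0
        have hs : Fin.tail T ∈ _ := hW (Fin.tail T) fun b => by
          simpa [Fin.tail] using hT b.succ
        have := (Finset.mem_filter.1 hs).2 h0
        have := (Finset.mem_filter.1 this).2
        rwa [Fin.cons_self_tail] at this

end Box

/-! ### Separating column sets. -/

/-- Large finite sets have, after reordering, large subsets lying one after another. -/
theorem exists_separated {n k : ℕ} (hk : 0 < k) : ∀ (t : ℕ) (S : Fin t → Finset (Fin n)),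
    (∀ b, t * k ≤ (S b).card) →
    ∃ (σ : Fin t → Fin t) (V : Fin t → Finset (Fin n)), Function.Injective σ ∧
      (∀ b, V b ⊆ S (σ b)) ∧ (∀ b, k ≤ (V b).card) ∧
      ∀ b b', b < b' → ∀ x ∈ V b, ∀ y ∈ V b', x < y
  | 0, S, _ => ⟨id, S, Function.injective_id, fun b => b.elim0, fun b => b.elim0,
      fun b => b.elim0⟩
  | t + 1, S, hS => by
      -- Greedy cut: take the shortest initial segment in which some set reaches k elements. By
      -- minimality no set has more than k there, so each other set keeps at least t * k beyond it.
      have hex : ∃ v : ℕ, ∃ p, k ≤ ((S p).filter fun x => x.val < v).card := by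
        refine ⟨n, 0, ?_⟩
        rw [Finset.filter_true_of_mem fun x _ => x.2]
        exact le_trans (by nlinarith) (hS 0)
      classical
      set v := Nat.find hex with hv
      obtain ⟨p, hp⟩ := Nat.find_spec hex
      have hv0 : 0 < v := by
        rcases Nat.eq_zero_or_pos v with h | h
        · rw [← hv, h] at hp; simp at hp; omega
        · exact h
      have hmin : ∀ p', ((S p').filter fun x => x.val < v - 1).card < k := by
        intro p'
        by_contra! h
        exact Nat.find_min hex (m := v - 1) (by omega) ⟨p', h⟩
      have hsmall : ∀ p', ((S p').filter fun x => x.val < v).card ≤ k := by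
        intro p'
        have hsub : ((S p').filter fun x => x.val < v) ⊆
            ((S p').filter fun x => x.val < v - 1) ∪
              (S p').filter (fun x => x.val = v - 1) := by
          intro x hx
          simp only [Finset.mem_filter, Finset.mem_union] at hx ⊢
          rcases lt_or_ge x.val (v - 1) with h | h
          · exact Or.inl ⟨hx.1, h⟩
          · exact Or.inr ⟨hx.1, by omega⟩
        have hone : ((S p').filter fun x => x.val = v - 1).card ≤ 1 := by
          rw [Finset.card_le_one]
          intro a ha b hb
          simp only [Finset.mem_filter] at ha hb
          exact Fin.ext (by omega)
        have := (Finset.card_le_card hsub).trans (Finset.card_union_le _ _)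
        have := hmin p'
        omega
      have hrest : ∀ b : Fin t, t * k ≤
          ((S (p.succAbove b)).filter fun x => ¬ x.val < v).card := by
        intro b
        have h1 := Finset.card_filter_add_card_filter_not (s := S (p.succAbove b))
          (fun x => x.val < v)
        have h2 := hsmall (p.succAbove b)
        have h3 := hS (p.succAbove b)
        have h4 : (t + 1) * k = t * k + k := by ring
        omega
      obtain ⟨σ, V, hσ, hVS, hVc, hVlt⟩ := exists_separated hk t _ hrest
      refine ⟨Fin.cons p fun b => p.succAbove (σ b),
        Fin.cons ((S p).filter fun x => x.val < v) V, ?_, ?_, ?_, ?_⟩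
      · rw [Fin.cons_injective_iff]
        refine ⟨?_, fun a b h => hσ (p.succAbove_right_injective h)⟩
        rintro ⟨b, hb⟩
        exact Fin.succAbove_ne p _ hb
      · intro b
        refine Fin.cases ?_ (fun b => ?_) b
        · simp [Finset.filter_subset]
        · simpa using (hVS b).trans (Finset.filter_subset _ _)
      · intro b
        refine Fin.cases ?_ (fun b => ?_) b
        · rw [Fin.cons_zero]; exact hp
        · simpa using hVc b
      · intro b b'
        refine Fin.cases ?_ (fun b => ?_) b <;> refine Fin.cases ?_ (fun b' => ?_) b'
        · simp
        · intro _ x hx y hy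
          simp only [Fin.cons_zero, Fin.cons_succ, Finset.mem_filter] at hx hy
          have h2 := (Finset.mem_filter.1 (hVS b' hy)).2
          rw [Fin.lt_def]
          omega
        · intro h; exact absurd h (Fin.not_lt_zero _)
        · intro h x hx y hy
          simp only [Fin.cons_succ] at hx hy
          exact hVlt b b' (Fin.succ_lt_succ_iff.1 h) x hx y hy

/-! ### Moments of common degrees and popular colours. -/

section Moments

variable {α β : Type}

open Classical in
/-- The elements of `R` related to every entry of the tuple `T`. -/
noncomputable def commonRows (rel : α → β → Prop) {t : ℕ} (R : Finset α) (T : Fin t → β) :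
    Finset α :=
  R.filter fun u => ∀ b, rel u (T b)

lemma mem_commonRows {rel : α → β → Prop} {t : ℕ} {R : Finset α} {T : Fin t → β} {u : α} :
    u ∈ commonRows rel R T ↔ u ∈ R ∧ ∀ b, rel u (T b) := by
  simp [commonRows]

lemma card_commonRows_le_sum {rel : α → β → Prop} {t L : ℕ} {R : Finset α}
    {P : Fin L → Finset α} (hP : ∀ u ∈ R, ∃ l, u ∈ P l) (T : Fin t → β) :
    (commonRows rel R T).card ≤
      ∑ l ∈ Finset.univ.filter (fun l => (commonRows rel (P l) T).Nonempty),
        (commonRows rel (P l) T).card := by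
  classical
  refine le_trans (Finset.card_le_card ?_) Finset.card_biUnion_le
  intro u hu
  rw [mem_commonRows] at hu
  obtain ⟨l, hl⟩ := hP u hu.1
  have : u ∈ commonRows rel (P l) T := mem_commonRows.2 ⟨hl, hu.2⟩
  exact Finset.mem_biUnion.2 ⟨l, by simpa using ⟨u, this⟩, this⟩

/-- Power mean over the at most r parts that meet the common rows; r ^ q replaces the sharper r ^ (q
- 1). -/
lemma pow_card_commonRows_le {rel : α → β → Prop} {t q L r : ℕ} {R : Finset α}
    {P : Fin L → Finset α} (hP : ∀ u ∈ R, ∃ l, u ∈ P l) (hq : 0 < q) (T : Fin t → β)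
    (hT : (Finset.univ.filter fun l => (commonRows rel (P l) T).Nonempty).card ≤ r) :
    (commonRows rel R T).card ^ q ≤ r ^ q * ∑ l, (commonRows rel (P l) T).card ^ q := by
  obtain ⟨q, rfl⟩ := Nat.exists_eq_succ_of_ne_zero hq.ne'
  set C := Finset.univ.filter fun l => (commonRows rel (P l) T).Nonempty
  have hpm : (∑ l ∈ C, (commonRows rel (P l) T).card) ^ (q + 1) ≤
      C.card ^ q * ∑ l ∈ C, (commonRows rel (P l) T).card ^ (q + 1) := by
    have := pow_sum_le_card_mul_sum_pow (s := C)
      (f := fun l => ((commonRows rel (P l) T).card : ℝ)) (fun _ _ => Nat.cast_nonneg _) q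
    exact_mod_cast this
  calc _ ≤ (∑ l ∈ C, (commonRows rel (P l) T).card) ^ (q + 1) :=
        Nat.pow_le_pow_left (card_commonRows_le_sum hP T) _
    _ ≤ _ := hpm
    _ ≤ r ^ (q + 1) * ∑ l, (commonRows rel (P l) T).card ^ (q + 1) := by
      rcases Nat.eq_zero_or_pos r with h0 | hr
      · have : C = ∅ := by rw [← Finset.card_eq_zero]; omega
        simp [this]
      · refine Nat.mul_le_mul ?_ (Finset.sum_le_sum_of_subset (Finset.subset_univ _))
        exact (Nat.pow_le_pow_left hT _).trans (Nat.pow_le_pow_right hr (Nat.le_succ _))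

variable [Fintype β]

/-- The `q`-th moment of the common degree into `R` of the `t`-tuples of columns. -/
noncomputable def starMoment (rel : α → β → Prop) (t q : ℕ) (R : Finset α) : ℕ :=
  ∑ T : Fin t → β, (commonRows rel R T).card ^ q

-- Tuples seeing fewer than r parts contribute at most a quarter of the moment, by `hspread`. The
-- rest is shared among at most 2 ^ L colours, so one of them has the stated mass.
open Classical in
lemma exists_popular_color {rel : α → β → Prop} {t q L r : ℕ} {R : Finset α}
    {P : Fin L → Finset α} (hP : ∀ u ∈ R, ∃ l, u ∈ P l) (hq : 0 < q)
    (hR : 0 < starMoment rel t q R)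
    (hspread : 4 * r ^ q * ∑ l, starMoment rel t q (P l) ≤ starMoment rel t q R) :
    ∃ C : Finset (Fin L), r ≤ C.card ∧
      (starMoment rel t q R : ℝ) / 2 ^ (L + 1) ≤
      ∑ T ∈ Finset.univ.filter (fun T : Fin t → β =>
        (Finset.univ.filter fun l => (commonRows rel (P l) T).Nonempty) = C),
          ((commonRows rel R T).card : ℝ) ^ q := by
  by_contra! hcon
  set col : (Fin t → β) → Finset (Fin L) :=
    fun T => Finset.univ.filter fun l => (commonRows rel (P l) T).Nonempty with hcol
  set Φ : ℝ := (starMoment rel t q R : ℝ) with hΦ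
  have hΦ0 : 0 < Φ := by rw [hΦ]; exact_mod_cast hR
  have htot : Φ = ∑ T : Fin t → β, ((commonRows rel R T).card : ℝ) ^ q := by
    rw [hΦ]; simp [starMoment]
  rw [← Finset.sum_filter_add_sum_filter_not _ (fun T => r ≤ (col T).card)] at htot
  have hbad : ∑ T ∈ Finset.univ.filter (fun T => ¬ r ≤ (col T).card),
      ((commonRows rel R T).card : ℝ) ^ q ≤ Φ / 4 := by
    have h1 : ∑ T ∈ Finset.univ.filter (fun T => ¬ r ≤ (col T).card),
        (commonRows rel R T).card ^ q ≤ r ^ q * ∑ l, starMoment rel t q (P l) := by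
      calc _ ≤ ∑ T ∈ Finset.univ.filter (fun T => ¬ r ≤ (col T).card),
            r ^ q * ∑ l, (commonRows rel (P l) T).card ^ q := by
            refine Finset.sum_le_sum fun T hT => pow_card_commonRows_le hP hq T ?_
            have := (Finset.mem_filter.1 hT).2
            simp only [hcol] at this
            omega
        _ ≤ ∑ T, r ^ q * ∑ l, (commonRows rel (P l) T).card ^ q :=
            Finset.sum_le_sum_of_subset (Finset.subset_univ _)
        _ = _ := by
            rw [← Finset.mul_sum, Finset.sum_comm]; rfl
    have h2 : 4 * ∑ T ∈ Finset.univ.filter (fun T => ¬ r ≤ (col T).card),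
        (commonRows rel R T).card ^ q ≤ starMoment rel t q R := by
      refine le_trans ?_ hspread
      rw [mul_assoc]
      exact Nat.mul_le_mul_left _ h1
    have h3 : 4 * ∑ T ∈ Finset.univ.filter (fun T => ¬ r ≤ (col T).card),
        ((commonRows rel R T).card : ℝ) ^ q ≤ Φ := by
      rw [hΦ]; exact_mod_cast h2
    linarith
  have hgood : ∑ T ∈ Finset.univ.filter (fun T => r ≤ (col T).card),
      ((commonRows rel R T).card : ℝ) ^ q ≤ Φ / 2 := by
    have hmaps : ∀ T ∈ Finset.univ.filter (fun T => r ≤ (col T).card),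
        col T ∈ Finset.univ.filter (fun C : Finset (Fin L) => r ≤ C.card) := by
      intro T hT
      simpa using hT
    rw [← Finset.sum_fiberwise_of_maps_to hmaps]
    calc _ ≤ ∑ _C ∈ Finset.univ.filter (fun C : Finset (Fin L) => r ≤ C.card),
          Φ / 2 ^ (L + 1) := by
          refine Finset.sum_le_sum fun C hC => ?_
          refine le_trans (Finset.sum_le_sum_of_subset_of_nonneg ?_ fun _ _ _ => by positivity)
            (hcon C (Finset.mem_filter.1 hC).2).le
          intro T hT
          simp only [Finset.mem_filter] at hT ⊢
          exact ⟨Finset.mem_univ _, hT.2⟩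
      _ ≤ ∑ _C : Finset (Fin L), Φ / 2 ^ (L + 1) :=
          Finset.sum_le_sum_of_subset_of_nonneg (Finset.subset_univ _)
            fun _ _ _ => by positivity
      _ = Φ / 2 := by
          rw [Finset.sum_const, Finset.card_univ, Fintype.card_finset, Fintype.card_fin,
            nsmul_eq_mul]
          push_cast
          rw [pow_succ]
          field_simp
  linarith

open Classical in
/-- Double counting of pairs of a `q`-tuple of rows and a `t`-tuple of columns. -/
lemma sum_pow_card_commonRows {rel : α → β → Prop} {t q : ℕ} (R : Finset α)
    (F : Finset (Fin t → β)) :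
    ∑ u ∈ Fintype.piFinset (fun _ : Fin q => R),
      ((Fintype.piFinset fun _ : Fin t =>
        Finset.univ.filter fun v : β => ∀ a, rel (u a) v).filter fun T => T ∈ F).card
      = ∑ T ∈ F, (commonRows rel R T).card ^ q := by
  have := Finset.sum_card_bipartiteAbove_eq_sum_card_bipartiteBelow
    (s := Fintype.piFinset (fun _ : Fin q => R)) (t := F) (fun u T => ∀ a b, rel (u a) (T b))
  refine Eq.trans (Finset.sum_congr rfl fun u _ => ?_)
    (this.trans (Finset.sum_congr rfl fun T _ => ?_))
  · congr 1
    ext T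
    simp only [Finset.mem_filter, Fintype.mem_piFinset, Finset.mem_univ, true_and,
      Finset.mem_bipartiteAbove]
    constructor
    · rintro ⟨h1, h2⟩; exact ⟨h2, fun a b => h1 b a⟩
    · rintro ⟨h1, h2⟩; exact ⟨fun b a => h2 a b, h1⟩
  · rw [← Fintype.card_piFinset_const]
    congr 1
    ext u
    simp only [Fintype.mem_piFinset, Finset.mem_bipartiteBelow, mem_commonRows]
    constructor
    · rintro ⟨h1, h2⟩ a; exact ⟨h1 a, h2 a⟩
    · intro h; exact ⟨fun a => (h a).1, fun a => (h a).2⟩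

end Moments

/-! ### Spread moments force monochromatic boxes. -/

/-- `K` is large enough that, whenever the moment of `R` is at least `K |R| ^ q` and is not
concentrated on few of the parts `P l`, there is a box of columns all of whose tuples have common
rows in the same `r` parts. -/
def IsSpreadConstant (t k r L K : ℕ) : Prop :=
  ∀ (α β : Type) [Fintype β] (rel : α → β → Prop) (q : ℕ) (R : Finset α) (P : Fin L → Finset α),
    (∀ u ∈ R, ∃ l, u ∈ P l) → 0 < q → 0 < starMoment rel t q R →
    4 * r ^ q * ∑ l, starMoment rel t q (P l) ≤ starMoment rel t q R →
    K * R.card ^ q ≤ starMoment rel t q R →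
    ∃ (C : Finset (Fin L)) (V : Fin t → Finset β), r ≤ C.card ∧ (∀ b, (V b).card = k + 1) ∧
      ∀ T : Fin t → β, (∀ b, T b ∈ V b) → ∀ l ∈ C, ∃ u ∈ P l, ∀ b, rel u (T b)

theorem exists_isSpreadConstant (t k r L : ℕ) : ∃ K : ℕ, IsSpreadConstant t k r L K := by
  classical
  set c : ℝ := 1 / 2 ^ (L + 2) with hc
  have hc0 : 0 < c := by positivity
  obtain ⟨n₀, hn₀⟩ := exists_box k t c hc0
  obtain ⟨K, hK⟩ := exists_nat_ge ((n₀ : ℝ) ^ t / c)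
  refine ⟨K, fun α β _ rel q R P hP hq hR hspread hKR => ?_⟩
  obtain ⟨C, hCr, hC⟩ := exists_popular_color hP hq hR hspread
  set F := Finset.univ.filter (fun T : Fin t → β =>
        (Finset.univ.filter fun l => (commonRows rel (P l) T).Nonempty) = C) with hF
  set Φ : ℝ := (starMoment rel t q R : ℝ) with hΦ
  set N : (Fin q → α) → Finset β := fun u => Finset.univ.filter fun v : β => ∀ a, rel (u a) v
    with hN
  have hRne : (Fintype.piFinset fun _ : Fin q => R).Nonempty := by
    rw [Fintype.piFinset_nonempty]
    intro _
    by_contra hne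
    rw [Finset.not_nonempty_iff_eq_empty] at hne
    subst hne
    simp [starMoment, commonRows, hq.ne'] at hR
  have hall : ∑ u ∈ Fintype.piFinset (fun _ : Fin q => R), ((N u).card : ℝ) ^ t = Φ := by
    have := sum_pow_card_commonRows (rel := rel) (t := t) (q := q) R Finset.univ
    simp only [Finset.mem_univ, Finset.filter_true, Fintype.card_piFinset_const] at this
    rw [hΦ, starMoment, ← this]
    push_cast
    rfl
  have hsome := sum_pow_card_commonRows (rel := rel) (t := t) (q := q) R F
  have hsome' : ∑ u ∈ Fintype.piFinset (fun _ : Fin q => R),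
      (((Fintype.piFinset fun _ : Fin t => N u).filter fun T => T ∈ F).card : ℝ)
      = ∑ T ∈ F, ((commonRows rel R T).card : ℝ) ^ q := by exact_mod_cast hsome
  have hcardR : (K : ℝ) * ((Fintype.piFinset fun _ : Fin q => R).card : ℝ) ≤ Φ := by
    rw [Fintype.card_piFinset_const, hΦ]
    exact_mod_cast hKR
  -- The popular mass Φ / 2 ^ (L + 1) equals 2cΦ. One half pays for density c inside the common
  -- neighbourhood `N u`; the other, through K |R|^q ≤ Φ, gives the term c * K that forces `N u` to
  -- be large.
  have hle : ∑ u ∈ Fintype.piFinset (fun _ : Fin q => R),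
      (c * ((N u).card : ℝ) ^ t + c * K) ≤ ∑ u ∈ Fintype.piFinset (fun _ : Fin q => R),
      (((Fintype.piFinset fun _ : Fin t => N u).filter fun T => T ∈ F).card : ℝ) := by
    rw [hsome', Finset.sum_add_distrib, ← Finset.mul_sum, hall, Finset.sum_const,
      nsmul_eq_mul]
    refine le_trans ?_ hC
    have h2 : Φ / 2 ^ (L + 1) = c * Φ + c * Φ := by
      rw [hc, pow_succ _ (L + 1)]
      field_simp
      ring
    rw [h2]
    nlinarith
  obtain ⟨u, -, hu⟩ := Finset.exists_le_of_sum_le hRne hle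
  have hNu : ((n₀ : ℕ) : ℝ) ^ t ≤ ((N u).card : ℝ) ^ t := by
    have h1 : (((Fintype.piFinset fun _ : Fin t => N u).filter fun T => T ∈ F).card : ℝ)
        ≤ ((N u).card : ℝ) ^ t := by
      have := Finset.card_filter_le (Fintype.piFinset fun _ : Fin t => N u) (fun T => T ∈ F)
      rw [Fintype.card_piFinset_const] at this
      exact_mod_cast this
    have h2 : (n₀ : ℝ) ^ t ≤ c * K := by rwa [div_le_iff₀' hc0] at hK
    have h3 : 0 ≤ c * ((N u).card : ℝ) ^ t := by positivity
    linarith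
  -- For t = 0 a bound on |N u| ^ t says nothing about |N u|, but then no column set is needed.
  rcases Nat.eq_zero_or_pos t with rfl | ht
  · have hne : (0 : ℝ) <
        (((Fintype.piFinset fun _ : Fin 0 => N u).filter fun T => T ∈ F).card : ℝ) := by
      refine lt_of_lt_of_le ?_ hu
      simp only [pow_zero, mul_one]
      positivity
    obtain ⟨T₀, hT₀⟩ := Finset.card_pos.1 (by exact_mod_cast hne)
    have hT₀ := (Finset.mem_filter.1 (Finset.mem_filter.1 hT₀).2).2
    refine ⟨C, fun b => b.elim0, hCr, fun b => b.elim0, fun T _ l hl => ?_⟩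
    rw [← hT₀] at hl
    obtain ⟨x, hx⟩ := (Finset.mem_filter.1 hl).2
    exact ⟨x, (mem_commonRows.1 hx).1, fun b => b.elim0⟩
  have hn : n₀ ≤ (N u).card := by
    have := le_of_pow_le_pow_left₀ ht.ne' (Nat.cast_nonneg _) hNu
    exact_mod_cast this
  obtain ⟨V, hVc, hV⟩ := hn₀ β (N u) _ hn (Finset.filter_subset (fun T => T ∈ F) _) (by
    have : 0 ≤ c * (K : ℝ) := by positivity
    linarith)
  refine ⟨C, V, hCr, hVc, fun T hT l hl => ?_⟩
  have h1 := (Finset.mem_filter.1 (Finset.mem_filter.1 (hV T hT)).2).2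
  rw [← h1] at hl
  obtain ⟨x, hx⟩ := (Finset.mem_filter.1 hl).2
  exact ⟨x, (mem_commonRows.1 hx).1, (mem_commonRows.1 hx).2⟩

/-! ### From a box to a copy of A. -/

/-- A box of columns whose tuples all have common rows in each of `r` successive row parts
yields a copy of a column-`t`-partite matrix. -/
theorem contains_of_box {m n r s t L : ℕ} (M : ZeroOneMatrix m n) (A : ZeroOneMatrix r s)
    (hA : IsColumnPartite t A) (P : Fin L → Finset (Fin m))
    (hP : ∀ l l', l < l' → ∀ x ∈ P l, ∀ y ∈ P l', x < y) (C : Finset (Fin L))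
    (hC : r ≤ C.card) (V : Fin t → Finset (Fin n)) (hVc : ∀ b, t * (s + 1) ≤ (V b).card)
    (hV : ∀ T : Fin t → Fin n, (∀ b, T b ∈ V b) → ∀ l ∈ C, ∃ u ∈ P l, ∀ b, M u (T b) = 1) :
    M.Contains A := by
  classical
  obtain ⟨c, hcm, hc⟩ := hA
  obtain ⟨σ, W, hσ, hWV, hWc, hWlt⟩ := exists_separated (Nat.succ_pos s) t V hVc
  have hbij : Function.Bijective σ := Finite.injective_iff_bijective.1 hσ
  set e := Equiv.ofBijective σ hbij with he
  have hWne : ∀ b, ∃ x, x ∈ W b := fun b => Finset.card_pos.1 (by have := hWc b; omega)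
  choose w hw using hWne
  set g : Fin s → Fin n := fun j =>
    (W (c j)).orderEmbOfCardLe ((Nat.le_succ s).trans (hWc (c j))) j with hg
  have hgm : ∀ j, g j ∈ W (c j) := fun j => Finset.orderEmbOfCardLe_mem _ _ _
  have hgs : StrictMono g := by
    intro j j' hjj
    rcases (hcm hjj.le).eq_or_lt with h | h
    · have hgj : g j = (W (c j')).orderEmbOfCardLe ((Nat.le_succ s).trans (hWc (c j'))) j := by
        simp only [hg]
        congr! 2
        rw [h]
      rw [hgj]
      exact (Finset.orderEmbOfCardLe _ _).strictMono hjj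
    · exact hWlt _ _ h _ (hgm j) _ (hgm j')
  have hrow : ∀ i : Fin r, ∀ l ∈ C, ∃ u ∈ P l, ∀ j, A i j = 1 → M u (g j) = 1 := by
    intro i l hl
    set U : Fin t → Fin n := fun b =>
      if h : ∃ j, c j = b ∧ A i j = 1 then g h.choose else w b with hU
    have hUW : ∀ b, U b ∈ W b := by
      intro b
      simp only [hU]
      split_ifs with h
      · have := hgm h.choose
        rwa [h.choose_spec.1] at this
      · exact hw b
    have hUA : ∀ j, A i j = 1 → U (c j) = g j := by
      intro j hj
      have h : ∃ j', c j' = c j ∧ A i j' = 1 := ⟨j, rfl, hj⟩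
      simp only [hU, dif_pos h]
      rw [hc i _ _ h.choose_spec.1 h.choose_spec.2 hj]
    -- The separated sets come in the order σ. The condition on a common row ignores the order of
    -- coordinates, so the tuple may be permuted back.
    obtain ⟨u, hu, hu'⟩ := hV (fun b => U (e.symm b)) (fun b => by
      have := hWV _ (hUW (e.symm b))
      have h2 : σ (e.symm b) = b := e.apply_symm_apply b
      rwa [h2] at this) l hl
    refine ⟨u, hu, fun j hj => ?_⟩
    have := hu' (e (c j))
    rwa [e.symm_apply_apply, hUA j hj] at this
  have hrow' : ∀ i : Fin r, ∃ u ∈ P (C.orderEmbOfCardLe hC i),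
      ∀ j, A i j = 1 → M u (g j) = 1 :=
    fun i => hrow i _ (Finset.orderEmbOfCardLe_mem _ _ _)
  choose f hf hfA using hrow'
  have hfs : StrictMono f := fun i i' hii =>
    hP _ _ ((C.orderEmbOfCardLe hC).strictMono hii) _ (hf i) _ (hf i')
  exact ⟨OrderEmbedding.ofStrictMono f hfs, OrderEmbedding.ofStrictMono g hgs,
    fun i j hij => hfA i j hij⟩

/-! ### Nested row blocks and the descent. -/

/-- The rows with index in `[a * L ^ i, (a + 1) * L ^ i)`. -/
def rowBlock (m L i a : ℕ) : Finset (Fin m) :=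
  Finset.univ.filter fun u => u.val / L ^ i = a

lemma card_rowBlock_le {m L : ℕ} (hL : 0 < L) (i a : ℕ) : (rowBlock m L i a).card ≤ L ^ i := by
  rw [← Finset.card_range (L ^ i)]
  refine Finset.card_le_card_of_injOn (fun u => u.val % L ^ i) ?_ ?_
  · intro u _
    simpa using Nat.mod_lt _ (by positivity)
  · intro u hu v hv huv
    simp only [rowBlock, Finset.coe_filter, Finset.mem_univ, true_and,
      Set.mem_ofPred_eq] at hu hv
    simp only at huv
    ext
    rw [← Nat.div_add_mod u.val (L ^ i), ← Nat.div_add_mod v.val (L ^ i), hu, hv, huv]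

lemma exists_mem_rowBlock {m L i a : ℕ} (hL : 0 < L) {u : Fin m}
    (hu : u ∈ rowBlock m L (i + 1) a) : ∃ l : Fin L, u ∈ rowBlock m L i (a * L + l) := by
  simp only [rowBlock, Finset.mem_filter, Finset.mem_univ, true_and] at hu ⊢
  refine ⟨⟨(u.val / L ^ i) % L, Nat.mod_lt _ hL⟩, ?_⟩
  rw [pow_succ, ← Nat.div_div_eq_div_mul] at hu
  subst hu
  exact (Nat.div_add_mod' _ _).symm

lemma rowBlock_lt {m L i a b : ℕ} (hab : a < b) {u v : Fin m} (hu : u ∈ rowBlock m L i a)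
    (hv : v ∈ rowBlock m L i b) : u < v := by
  simp only [rowBlock, Finset.mem_filter, Finset.mem_univ, true_and] at hu hv
  by_contra! h
  have : v.val / L ^ i ≤ u.val / L ^ i := Nat.div_le_div_right h
  omega

/-- The logarithm of the `q`-th moment that blocks of `L ^ i` rows are required to have. -/
noncomputable def momentExponent (t N η δ : ℝ) (q i : ℕ) : ℝ :=
  N * (t - t / (2 * q) + η) + i * (1 + δ)

/-- Relative size (on a logarithmic scale) up to which the `q`-th moment can be used. -/
noncomputable def sizeThreshold (t : ℝ) (q : ℕ) : ℝ :=
  t * (2 * q - 1) / (2 * q * (q - 1))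

/-- The incidence relation of a zero-one matrix. -/
def incidence {m n : ℕ} (M : ZeroOneMatrix m n) (u : Fin m) (v : Fin n) : Prop := M u v = 1

lemma four_mul_pow_mul_sum_le {L r q Φ : ℕ} {E δ : ℝ} (hL0 : (0 : ℝ) < L)
    (hLδ : 4 * (r : ℝ) ^ q ≤ (L : ℝ) ^ δ) {f : Fin L → ℕ}
    (hf : ∀ l, (f l : ℝ) ≤ (L : ℝ) ^ E) (h : (L : ℝ) ^ (E + 1 + δ) ≤ Φ) :
    4 * r ^ q * ∑ l, f l ≤ Φ := by
  have h1 : (∑ l, (f l : ℝ)) ≤ L * (L : ℝ) ^ E := by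
    calc _ ≤ ∑ _l : Fin L, (L : ℝ) ^ E := Finset.sum_le_sum fun l _ => hf l
      _ = _ := by simp
  have h2 : 4 * (r : ℝ) ^ q * (∑ l, (f l : ℝ)) ≤ Φ := by
    calc _ ≤ (L : ℝ) ^ δ * (L * (L : ℝ) ^ E) :=
          mul_le_mul hLδ h1 (Finset.sum_nonneg fun _ _ => Nat.cast_nonneg _) (by positivity)
      _ = (L : ℝ) ^ (E + 1 + δ) := by
          rw [Real.rpow_add hL0, Real.rpow_add hL0, Real.rpow_one]; ring
      _ ≤ _ := h
  exact_mod_cast h2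

/-- This is where `sizeThreshold` comes from: below it (i + 1) q ≤ N (t - t/(2q)) + (i + 1), and the
slack L^(Nη) absorbs K. -/
lemma mul_card_pow_le {t L K q i c Φ : ℕ} {N η δ : ℝ} (hL0 : (0 : ℝ) < L) (hL1 : (1 : ℝ) ≤ L)
    (hq : 2 ≤ q) (hδ : 0 ≤ δ) (hLK : (K : ℝ) ≤ (L : ℝ) ^ (N * η))
    (hi : ((i + 1 : ℕ) : ℝ) ≤ N * sizeThreshold t q) (hc : c ≤ L ^ (i + 1))
    (h : (L : ℝ) ^ momentExponent t N η δ q (i + 1) ≤ Φ) : K * c ^ q ≤ Φ := by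
  have h1 : (c : ℝ) ≤ (L : ℝ) ^ (i + 1) := by exact_mod_cast hc
  have hq1 : (0 : ℝ) < q - 1 := by
    have : (2 : ℝ) ≤ q := by exact_mod_cast hq
    linarith
  have hq0 : (0 : ℝ) < q := by linarith
  have h3 : ((i + 1 : ℕ) : ℝ) * (q - 1) ≤ N * (t - t / (2 * q)) := by
    calc _ ≤ N * sizeThreshold t q * (q - 1) := mul_le_mul_of_nonneg_right hi hq1.le
      _ = _ := by simp only [sizeThreshold]; field_simp
  have h4 : 0 ≤ ((i + 1 : ℕ) : ℝ) * δ := mul_nonneg (Nat.cast_nonneg _) hδ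
  have h5 : N * η + ((i + 1 : ℕ) : ℝ) * q ≤ momentExponent t N η δ q (i + 1) := by
    simp only [momentExponent]
    linarith
  have h2 : (K : ℝ) * (c : ℝ) ^ q ≤ Φ := by
    calc _ ≤ (L : ℝ) ^ (N * η) * ((L : ℝ) ^ (i + 1)) ^ q :=
          mul_le_mul hLK (pow_le_pow_left₀ (Nat.cast_nonneg _) h1 q) (by positivity)
            (by positivity)
      _ = (L : ℝ) ^ (N * η + ((i + 1 : ℕ) : ℝ) * q) := by
          rw [Real.rpow_add hL0, Real.rpow_mul hL0.le _ (q : ℝ), Real.rpow_natCast,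
            Real.rpow_natCast]
      _ ≤ (L : ℝ) ^ momentExponent t N η δ q (i + 1) :=
          Real.rpow_le_rpow_of_exponent_le hL1 h5
      _ ≤ _ := h
  exact_mod_cast h2

/-- One level of the descent: otherwise the moment is spread over the L sub-blocks, since L^δ beats
4 r^q, and the spread constant produces A. -/
lemma exists_subblock {r s t L K : ℕ} (A : ZeroOneMatrix r s) (hA : IsColumnPartite t A)
    (hK : IsSpreadConstant t (t * (s + 1)) r L K)
    {m n : ℕ} {M : ZeroOneMatrix m n} (hM : ¬ M.Contains A) (hL : 1 < L) {N η δ : ℝ} {q i : ℕ}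
    (hq : 2 ≤ q) (hδ : 0 ≤ δ)
    (hLδ : 4 * (r : ℝ) ^ q ≤ (L : ℝ) ^ δ) (hLK : (K : ℝ) ≤ (L : ℝ) ^ (N * η))
    (hi : ((i + 1 : ℕ) : ℝ) ≤ N * sizeThreshold t q) {a : ℕ}
    (h : (L : ℝ) ^ momentExponent t N η δ q (i + 1) ≤
      starMoment (incidence M) t q (rowBlock m L (i + 1) a)) :
    ∃ a', (L : ℝ) ^ momentExponent t N η δ q i ≤
      starMoment (incidence M) t q (rowBlock m L i a') := by
  by_contra! hcon
  have hL0 : (0 : ℝ) < L := by exact_mod_cast (by omega : 0 < L)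
  have hL1 : (1 : ℝ) ≤ L := by exact_mod_cast hL.le
  set R := rowBlock m L (i + 1) a with hR
  set Φ := starMoment (incidence M) t q R with hΦ
  set P : Fin L → Finset (Fin m) := fun l => rowBlock m L i (a * L + l) with hPdef
  have hE : momentExponent t N η δ q (i + 1) = momentExponent t N η δ q i + 1 + δ := by
    simp only [momentExponent]; push_cast; ring
  have hΦ0 : 0 < Φ := by
    have : (0 : ℝ) < Φ := lt_of_lt_of_le (by positivity) h
    exact_mod_cast this
  have hspread : 4 * r ^ q * ∑ l, starMoment (incidence M) t q (P l) ≤ Φ := by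
    refine four_mul_pow_mul_sum_le hL0 hLδ (fun l => (hcon (a * L + l)).le) ?_
    rwa [← hE]
  have hKR : K * R.card ^ q ≤ Φ :=
    mul_card_pow_le hL0 hL1 hq hδ hLK hi (card_rowBlock_le (by omega) (i + 1) a) h
  obtain ⟨C, V, hC, hVc, hV⟩ := hK _ _ (incidence M) q R P
    (fun u hu => exists_mem_rowBlock (by omega) hu) (by omega) hΦ0 hspread hKR
  exact hM (contains_of_box M A hA P
    (fun l l' hll x hx y hy => rowBlock_lt (by simpa using hll) hx hy) C hC V
    (fun b => by rw [hVc]; exact Nat.le_succ _) hV)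

lemma sizeThreshold_succ {t : ℝ} {q : ℕ} :
    sizeThreshold t (q + 1) = t * (2 * q + 1) / (2 * (q + 1) * q) := by
  simp only [sizeThreshold]; push_cast; ring_nf

/-- The power mean inequality between consecutive moments. -/
lemma rpow_le_starMoment_succ {α : Type} {n t L N : ℕ} (hL : 1 < L) (hn : n ≤ L ^ N)
    {rel : α → Fin n → Prop} {R : Finset α} {η δ : ℝ} {q i : ℕ} (hq : 1 ≤ q)
    (hi : N * sizeThreshold t (q + 1) ≤ N * η + i * (1 + δ))
    (h : (L : ℝ) ^ momentExponent t N η δ q i ≤ starMoment rel t q R) :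
    (L : ℝ) ^ momentExponent t N η δ (q + 1) i ≤ starMoment rel t (q + 1) R := by
  have hL0 : (0 : ℝ) < L := by exact_mod_cast (by omega : 0 < L)
  have hL1 : (1 : ℝ) ≤ L := by exact_mod_cast hL.le
  have hq0 : (0 : ℝ) < q := by exact_mod_cast hq
  have hp : (1 : ℝ) ≤ (q + 1) / q := by rw [le_div_iff₀ hq0]; linarith
  have hpm := Real.rpow_sum_le_const_mul_sum_rpow_of_nonneg
    (s := (Finset.univ : Finset (Fin t → Fin n)))
    (f := fun T => ((commonRows rel R T).card : ℝ) ^ q) hp (fun _ _ => by positivity)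
  have hterm : ∀ T : Fin t → Fin n, (((commonRows rel R T).card : ℝ) ^ q) ^ (((q : ℝ) + 1) / q)
      = ((commonRows rel R T).card : ℝ) ^ (q + 1) := by
    intro T
    rw [← Real.rpow_natCast _ q, ← Real.rpow_mul (Nat.cast_nonneg _),
      mul_div_cancel₀ _ hq0.ne', ← Real.rpow_natCast _ (q + 1)]
    push_cast
    rfl
  simp only [hterm, Finset.card_univ, Fintype.card_fun, Fintype.card_fin] at hpm
  have e1 : (∑ T : Fin t → Fin n, ((commonRows rel R T).card : ℝ) ^ q)
      = (starMoment rel t q R : ℝ) := by simp [starMoment]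
  have e2 : (∑ T : Fin t → Fin n, ((commonRows rel R T).card : ℝ) ^ (q + 1))
      = (starMoment rel t (q + 1) R : ℝ) := by simp [starMoment]
  rw [e1, e2] at hpm
  set E := momentExponent t N η δ q i with hE
  -- The difference of the two sides is exactly (Nη + i(1 + δ) - N * `sizeThreshold t (q + 1)`) / q.
  have hexp : momentExponent t N η δ (q + 1) i + N * t * (1 / q) ≤ E * ((q + 1) / q) := by
    rw [sizeThreshold_succ] at hi
    rw [hE]
    simp only [momentExponent]
    push_cast
    rw [← sub_nonneg]
    have hid : (N * (t - t / (2 * (q : ℝ)) + η) + i * (1 + δ)) * ((q + 1) / q) -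
        (N * (t - t / (2 * ((q : ℝ) + 1)) + η) + i * (1 + δ) + N * t * (1 / q))
        = (N * η + i * (1 + δ) - N * (t * (2 * q + 1) / (2 * (q + 1) * q))) / q := by
      field_simp
      ring
    rw [hid]
    exact div_nonneg (sub_nonneg.2 hi) hq0.le
  have hchain : (L : ℝ) ^ (momentExponent t N η δ (q + 1) i + N * t * (1 / q)) ≤
      (L : ℝ) ^ ((N : ℝ) * t * (1 / q)) * starMoment rel t (q + 1) R := by
    calc _ ≤ (L : ℝ) ^ (E * ((q + 1) / q)) := Real.rpow_le_rpow_of_exponent_le hL1 hexp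
      _ = ((L : ℝ) ^ E) ^ (((q : ℝ) + 1) / q) := Real.rpow_mul hL0.le _ _
      _ ≤ (starMoment rel t q R : ℝ) ^ (((q : ℝ) + 1) / q) := by gcongr
      _ ≤ _ := hpm
      _ ≤ _ := by
        gcongr
        have h1 : (((n ^ t : ℕ) : ℝ)) ≤ (L : ℝ) ^ ((N : ℝ) * t) := by
          rw [Real.rpow_mul hL0.le, Real.rpow_natCast, Real.rpow_natCast]
          exact_mod_cast Nat.pow_le_pow_left hn t
        have h2 : ((q : ℝ) + 1) / q - 1 = 1 / q := by field_simp; ring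
        rw [h2, Real.rpow_mul hL0.le]
        gcongr
  rw [Real.rpow_add hL0, mul_comm] at hchain
  exact le_of_mul_le_mul_left hchain (by positivity)

lemma starMoment_singleton_le {m n t q L : ℕ} (hL : 0 < L) {rel : Fin m → Fin n → Prop}
    (a : ℕ) : starMoment rel t q (rowBlock m L 0 a) ≤ n ^ t := by
  calc _ ≤ ∑ _T : Fin t → Fin n, 1 := by
        refine Finset.sum_le_sum fun T _ => ?_
        refine pow_le_one' ?_ _
        have h1 := card_rowBlock_le (m := m) hL 0 a
        rw [pow_zero] at h1
        refine le_trans (Finset.card_le_card ?_) h1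
        exact fun u hu => (mem_commonRows.1 hu).1
    _ = n ^ t := by simp

/-- Descending through nested blocks of rows, a matrix avoiding `A` cannot have a large
`t`-th moment. -/
theorem contains_of_starMoment {r s t L K Q N n : ℕ} (ht : 2 ≤ t) (A : ZeroOneMatrix r s)
    (hA : IsColumnPartite t A)
    (hK : IsSpreadConstant t (t * (s + 1)) r L K)
    {M : ZeroOneMatrix n n} (hL : 1 < L) {η δ : ℝ} (hδ : 0 ≤ δ)
    (htQ : t ≤ Q) (hQ : t / (2 * Q) < η)
    (hLδ : ∀ q ≤ Q, 4 * (r : ℝ) ^ q ≤ (L : ℝ) ^ δ) (hLK : (K : ℝ) ≤ (L : ℝ) ^ (N * η))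
    (hn : n ≤ L ^ N) (hNη : 1 ≤ N * η) (hNQ : Q ^ 2 ≤ N)
    (h : (L : ℝ) ^ momentExponent t N η δ t N ≤ starMoment (incidence M) t t Finset.univ) :
    M.Contains A := by
  by_contra hM
  have hL0 : (0 : ℝ) < L := by exact_mod_cast (by omega : 0 < L)
  have hL1 : (1 : ℝ) < L := by exact_mod_cast hL
  have htR : (2 : ℝ) ≤ t := by exact_mod_cast ht
  have hN0 : (0 : ℝ) < N := by
    have : 0 < Q ^ 2 := pow_pos (by omega) 2
    exact_mod_cast (by omega : 0 < N)
  -- After j levels, q is the moment in use: the level lies below the threshold of q and, unless q =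
  -- Q, not below that of q + 1.
  have key : ∀ j ≤ N, ∃ a q, t ≤ q ∧ q ≤ Q ∧ ((N - j : ℕ) : ℝ) ≤ N * sizeThreshold t q ∧
      (q = Q ∨ N * sizeThreshold t (q + 1) ≤ ((N - j : ℕ) : ℝ)) ∧
      (L : ℝ) ^ momentExponent t N η δ q (N - j) ≤
        starMoment (incidence M) t q (rowBlock n L (N - j) a) := by
    intro j
    induction j with
    | zero =>
      intro _
      refine ⟨0, t, le_rfl, htQ, ?_, Or.inr ?_, ?_⟩
      · have : 1 ≤ sizeThreshold t t := by
          simp only [sizeThreshold]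
          rw [le_div_iff₀ (by nlinarith)]
          nlinarith
        simp only [Nat.sub_zero]
        nlinarith
      · have : sizeThreshold t (t + 1) ≤ 1 := by
          rw [sizeThreshold_succ, div_le_one (by nlinarith)]
          nlinarith
        simp only [Nat.sub_zero]
        nlinarith
      · have : rowBlock n L (N - 0) 0 = Finset.univ := by
          simp only [rowBlock, Finset.filter_eq_self, Finset.mem_univ, true_imp_iff]
          exact fun u => Nat.div_eq_of_lt (u.2.trans_le hn)
        rw [this]
        exact h
    | succ j ih =>
      intro hj
      obtain ⟨a, q, htq, hqQ, hle, hor, hmom⟩ := ih (by omega)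
      have hsucc : N - j = N - (j + 1) + 1 := by omega
      set i := N - (j + 1) with hi
      rw [hsucc] at hle hor hmom
      obtain ⟨a', ha'⟩ := exists_subblock A hA hK hM hL (by omega) hδ (hLδ q hqQ) hLK hle hmom
      have hiR : ((i + 1 : ℕ) : ℝ) = (i : ℝ) + 1 := by push_cast; rfl
      by_cases hcase : q = Q ∨ N * sizeThreshold t (q + 1) ≤ (i : ℝ)
      · exact ⟨a', q, htq, hqQ, by linarith, hcase, ha'⟩
      · push Not at hcase
        have hge : N * sizeThreshold t (q + 1) ≤ (i : ℝ) + 1 := by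
          rw [← hiR]; exact hor.resolve_left hcase.1
        have hqR : (2 : ℝ) ≤ q := htR.trans (by exact_mod_cast htq)
        refine ⟨a', q + 1, by omega, by omega, hcase.2.le, ?_, ?_⟩
        · right
          have hqQ' : (q : ℝ) + 1 ≤ Q := by exact_mod_cast (by omega : q + 1 ≤ Q)
          have hNR : (Q : ℝ) ^ 2 ≤ N := by exact_mod_cast hNQ
          -- As Q ^ 2 ≤ N, consecutive thresholds are at least one level apart, so raising q by one
          -- suffices.
          have hgap : 1 ≤ N * (sizeThreshold t (q + 1) - sizeThreshold t (q + 1 + 1)) := by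
            rw [sizeThreshold_succ, sizeThreshold_succ]
            push_cast
            have hid : (t : ℝ) * (2 * q + 1) / (2 * (q + 1) * q) -
                t * (2 * ((q : ℝ) + 1) + 1) / (2 * (q + 1 + 1) * (q + 1)) =
                t / (q * (q + 2)) := by
              field_simp
              ring
            rw [hid, ← mul_div_assoc, le_div_iff₀ (by positivity)]
            nlinarith
          linarith
        -- The level undershoots the threshold by at most 1, which Nη ≥ 1 makes up for.
        · refine rpow_le_starMoment_succ hL hn (by omega) ?_ ha'
          have : 0 ≤ (i : ℝ) * δ := by positivity
          nlinarith
  obtain ⟨a, q, htq, hqQ, -, hor, hmom⟩ := key N le_rfl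
  rw [Nat.sub_self] at hor hmom
  have hqR : (2 : ℝ) ≤ q := htR.trans (by exact_mod_cast htq)
  rcases hor with rfl | hor
  -- At level 0 a block has at most one row, so its moment is at most n^t; but η > t/(2Q) asks for
  -- more than L^(Nt).
  · have h1 : (L : ℝ) ^ momentExponent t N η δ q 0 ≤ (L : ℝ) ^ ((N : ℝ) * t) := by
      refine hmom.trans ?_
      rw [Real.rpow_mul hL0.le, Real.rpow_natCast, Real.rpow_natCast]
      have := (starMoment_singleton_le (by omega) a :
        starMoment (incidence M) t q (rowBlock n L 0 a) ≤ n ^ t)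
      exact_mod_cast this.trans (Nat.pow_le_pow_left hn t)
    rw [Real.rpow_le_rpow_left_iff hL1] at h1
    simp only [momentExponent] at h1
    push_cast at h1
    nlinarith
  · rw [sizeThreshold_succ] at hor
    have : 0 < N * ((t : ℝ) * (2 * q + 1) / (2 * (q + 1) * q)) := by positivity
    push_cast at hor
    linarith

/-! ### From weight to moments, and the choice of constants. -/

lemma pow_weight_le {m n t : ℕ} (M : ZeroOneMatrix m n) :
    weight M ^ (t + 1) ≤ m ^ t * starMoment (incidence M) (t + 1) 1 Finset.univ := by
  classical
  have h1 : weight M = ∑ u : Fin m, (Finset.univ.filter fun v : Fin n => M u v = 1).card := by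
    simp only [weight, Finset.card_filter]
    rw [Fintype.sum_prod_type]
  have h2 : starMoment (incidence M) (t + 1) 1 Finset.univ =
      ∑ u : Fin m, (Finset.univ.filter fun v : Fin n => M u v = 1).card ^ (t + 1) := by
    have := Finset.sum_card_bipartiteAbove_eq_sum_card_bipartiteBelow
      (s := (Finset.univ : Finset (Fin m))) (t := (Finset.univ : Finset (Fin (t + 1) → Fin n)))
      (fun u T => ∀ b, M u (T b) = 1)
    simp only [starMoment, pow_one]
    refine Eq.trans (Finset.sum_congr rfl fun T _ => ?_)
      (this.symm.trans (Finset.sum_congr rfl fun u _ => ?_))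
    · congr 1
      ext u
      simp [mem_commonRows, incidence]
    · rw [← Fintype.card_piFinset_const]
      congr 1
      ext T
      simp
  rw [h1, h2]
  have := pow_sum_le_card_mul_sum_pow (s := (Finset.univ : Finset (Fin m)))
    (f := fun u => ((Finset.univ.filter fun v : Fin n => M u v = 1).card : ℝ))
    (fun _ _ => Nat.cast_nonneg _) t
  rw [Finset.card_univ, Fintype.card_fin] at this
  exact_mod_cast this

lemma pow_starMoment_one_le {α : Type} {n t q : ℕ} (rel : α → Fin n → Prop) (R : Finset α) :
    starMoment rel t 1 R ^ (q + 1) ≤ (n ^ t) ^ q * starMoment rel t (q + 1) R := by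
  have := pow_sum_le_card_mul_sum_pow (s := (Finset.univ : Finset (Fin t → Fin n)))
    (f := fun T => ((commonRows rel R T).card : ℝ)) (fun _ _ => Nat.cast_nonneg _) q
  rw [Finset.card_univ, Fintype.card_fun, Fintype.card_fin, Fintype.card_fin] at this
  simp only [starMoment, pow_one]
  exact_mod_cast this

/-- Convexity twice: over row degrees to reach the first moment, then over column tuples to reach
the t-th. -/
lemma pow_weight_le_starMoment {n t : ℕ} (ht : 1 ≤ t) (M : ZeroOneMatrix n n) :
    weight M ^ (t * t) ≤ n ^ (2 * t * (t - 1)) * starMoment (incidence M) t t Finset.univ := by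
  obtain ⟨t, rfl⟩ := Nat.exists_eq_succ_of_ne_zero (by omega : t ≠ 0)
  have h1 := pow_weight_le (t := t) M
  have h2 := pow_starMoment_one_le (t := t + 1) (q := t) (incidence M) Finset.univ
  calc weight M ^ ((t + 1) * (t + 1)) = (weight M ^ (t + 1)) ^ (t + 1) := pow_mul _ _ _
    _ ≤ (n ^ t * starMoment (incidence M) (t + 1) 1 Finset.univ) ^ (t + 1) :=
        Nat.pow_le_pow_left h1 _
    _ = (n ^ t) ^ (t + 1) * starMoment (incidence M) (t + 1) 1 Finset.univ ^ (t + 1) :=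
        mul_pow _ _ _
    _ ≤ (n ^ t) ^ (t + 1) *
        ((n ^ (t + 1)) ^ t * starMoment (incidence M) (t + 1) (t + 1) Finset.univ) :=
        Nat.mul_le_mul_left _ h2
    _ = _ := by
        rw [← mul_assoc, ← pow_mul, ← pow_mul, ← pow_add]
        congr 2
        simp only [Nat.succ_eq_add_one, Nat.add_sub_cancel]
        ring

/-- The exponent `2 - 1 / t + 1 / (2 t ^ 2)`. -/
noncomputable def extremalExponent (t : ℝ) : ℝ := 2 - 1 / t + 1 / (2 * t ^ 2)

theorem eventually_contains {t r s : ℕ} (ht : 2 ≤ t) (A : ZeroOneMatrix r s)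
    (hA : IsColumnPartite t A) {ε : ℝ} (hε : 0 < ε) :
    ∀ᶠ n : ℕ in atTop, ∀ M : ZeroOneMatrix n n,
      (n : ℝ) ^ (extremalExponent t + ε) ≤ weight M → M.Contains A := by
  have htR : (2 : ℝ) ≤ t := by exact_mod_cast ht
  -- In the power t² the excess ε becomes 4η: 2η serves as the slacks η and δ = η of
  -- `momentExponent`, and 2η absorbs rounding n up to a power of L.
  set η : ℝ := ε * t ^ 2 / 4 with hη
  have hη0 : 0 < η := by positivity
  obtain ⟨Q₀, hQ₀⟩ := exists_nat_gt (t / (2 * η))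
  set Q := max t Q₀ with hQdef
  have htQ : t ≤ Q := le_max_left _ _
  have hQ0 : (0 : ℝ) < Q := by exact_mod_cast (by omega : 0 < Q)
  have hQ : t / (2 * Q) < η := by
    have h1 : t / (2 * η) < Q := hQ₀.trans_le (by exact_mod_cast le_max_right t Q₀)
    rw [div_lt_iff₀ (by positivity)] at h1 ⊢
    linarith
  -- L must precede K, which depends on it; N is taken large afterwards. The base r + 1 ≥ 1 makes
  -- the bound for Q cover all q ≤ Q.
  obtain ⟨L, hL4, hL1⟩ : ∃ L : ℕ, 4 * ((r : ℝ) + 1) ^ Q ≤ (L : ℝ) ^ η ∧ 1 < L := by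
    have h1 := ((tendsto_rpow_atTop hη0).comp tendsto_natCast_atTop_atTop).eventually_ge_atTop
      (4 * ((r : ℝ) + 1) ^ Q)
    exact (h1.and (eventually_gt_atTop 1)).exists
  have hL0 : (0 : ℝ) < L := by exact_mod_cast (by omega : 0 < L)
  have hL1R : (1 : ℝ) < L := by exact_mod_cast hL1
  have hLδ : ∀ q ≤ Q, 4 * (r : ℝ) ^ q ≤ (L : ℝ) ^ η := by
    intro q hq
    refine le_trans ?_ hL4
    have h1 : (r : ℝ) ^ q ≤ ((r : ℝ) + 1) ^ q :=
      pow_le_pow_left₀ (Nat.cast_nonneg _) (by linarith) q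
    have h2 : ((r : ℝ) + 1) ^ q ≤ ((r : ℝ) + 1) ^ Q :=
      pow_le_pow_right₀ (by linarith [Nat.cast_nonneg (α := ℝ) r]) hq
    linarith
  obtain ⟨K, hK⟩ := exists_isSpreadConstant t (t * (s + 1)) r L
  have hLη : (1 : ℝ) < (L : ℝ) ^ η := Real.one_lt_rpow hL1R hη0
  have hN : ∀ᶠ N : ℕ in atTop, (K : ℝ) ≤ (L : ℝ) ^ (N * η) ∧ 1 ≤ N * η ∧ Q ^ 2 ≤ N := by
    have h1 := (tendsto_pow_atTop_atTop_of_one_lt hLη).eventually_ge_atTop (K : ℝ)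
    have h2 := (tendsto_natCast_atTop_atTop (R := ℝ)).eventually_ge_atTop (1 / η)
    filter_upwards [h1, h2, eventually_ge_atTop (Q ^ 2)] with N h1 h2 h3
    refine ⟨?_, ?_, h3⟩
    · rwa [mul_comm, Real.rpow_mul hL0.le, Real.rpow_natCast]
    · rwa [div_le_iff₀ hη0] at h2
  obtain ⟨N₀, hN₀⟩ := eventually_atTop.1 hN
  have hbig := ((tendsto_rpow_atTop (by positivity : 0 < 2 * η)).comp
    tendsto_natCast_atTop_atTop).eventually_ge_atTop ((L : ℝ) ^ ((t : ℝ) + 1 / 2 + 2 * η))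
  filter_upwards [hbig, eventually_gt_atTop (L ^ N₀), eventually_gt_atTop 1] with n hbig hnN hn1
  intro M hM
  have hn0 : (0 : ℝ) < n := by exact_mod_cast (by omega : 0 < n)
  set N := Nat.clog L n with hNdef
  have hnL : n ≤ L ^ N := Nat.le_pow_clog hL1 n
  have hNpos : 0 < N := Nat.clog_pos hL1 hn1
  have hLn : L ^ N ≤ L * n := by
    have h1 : L ^ N.pred < n := Nat.pow_pred_clog_lt_self hL1 hn1
    have h2 : L ^ N = L * L ^ N.pred := by
      rw [← pow_succ', Nat.pred_eq_sub_one, Nat.sub_add_cancel hNpos]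
    rw [h2]
    exact Nat.mul_le_mul_left _ h1.le
  have hNN : N₀ ≤ N := by
    have : L ^ N₀ < L ^ N := hnN.trans_le hnL
    exact ((Nat.pow_lt_pow_iff_right hL1).1 this).le
  obtain ⟨hLK, hNη, hNQ⟩ := hN₀ N hNN
  refine contains_of_starMoment ht A hA hK hL1 hη0.le htQ hQ hLδ hLK hnL hNη hNQ ?_
  have hE : momentExponent t N η η t N = N * ((t : ℝ) + 1 / 2 + 2 * η) := by
    simp only [momentExponent]
    field_simp
    ring
  have hLR : (L : ℝ) ^ N ≤ L * n := by exact_mod_cast hLn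
  have hΦ : ((weight M : ℝ)) ^ (t * t) ≤ (n : ℝ) ^ (2 * t * (t - 1)) *
      starMoment (incidence M) t t Finset.univ := by
    exact_mod_cast pow_weight_le_starMoment (by omega) M
  have hexp : (extremalExponent t + ε) * ((t * t : ℕ) : ℝ) =
      ((2 * t * (t - 1) : ℕ) : ℝ) + ((2 * η) + ((t : ℝ) + 1 / 2 + 2 * η)) := by
    have h1 : (((t - 1 : ℕ)) : ℝ) = t - 1 := by push_cast [Nat.cast_sub (by omega : 1 ≤ t)]; rfl
    simp only [extremalExponent]
    push_cast
    rw [h1, hη]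
    field_simp
    ring
  have hlow : (n : ℝ) ^ (2 * t * (t - 1)) * ((n : ℝ) ^ (2 * η) *
      (n : ℝ) ^ ((t : ℝ) + 1 / 2 + 2 * η)) ≤ (weight M : ℝ) ^ (t * t) := by
    rw [← Real.rpow_natCast, ← Real.rpow_add hn0, ← Real.rpow_add hn0, ← hexp,
      Real.rpow_mul hn0.le, Real.rpow_natCast]
    exact pow_le_pow_left₀ (by positivity) hM _
  have hfin := le_of_mul_le_mul_left (hlow.trans hΦ) (by positivity)
  refine le_trans ?_ hfin
  rw [hE, Real.rpow_mul hL0.le, Real.rpow_natCast]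
  calc ((L : ℝ) ^ N) ^ ((t : ℝ) + 1 / 2 + 2 * η) ≤ (L * n : ℝ) ^ ((t : ℝ) + 1 / 2 + 2 * η) :=
        Real.rpow_le_rpow (by positivity) hLR (by positivity)
    _ = (L : ℝ) ^ ((t : ℝ) + 1 / 2 + 2 * η) * (n : ℝ) ^ ((t : ℝ) + 1 / 2 + 2 * η) :=
        Real.mul_rpow hL0.le hn0.le
    _ ≤ _ := mul_le_mul_of_nonneg_right hbig (by positivity)

theorem eventually_ex_lt {t r s : ℕ} (ht : 2 ≤ t) (A : ZeroOneMatrix r s)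
    (hA : IsColumnPartite t A) {ε : ℝ} (hε : 0 < ε) :
    ∀ᶠ n : ℕ in atTop, (ex n A : ℝ) < (n : ℝ) ^ (extremalExponent t + ε) := by
  filter_upwards [eventually_contains ht A hA hε, eventually_gt_atTop 0] with n hn hn0
  classical
  have hn0R : (0 : ℝ) < n := by exact_mod_cast hn0
  rw [← Nat.lt_ceil, ex, Finset.sup_lt_iff (by
    rw [Nat.bot_eq_zero]; exact Nat.ceil_pos.2 (by positivity))]
  intro M hM
  rw [Nat.lt_ceil]
  by_contra! h
  exact (Finset.mem_filter.1 hM).2 (hn M h)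

/-! ### Passing to the o(1) form. -/

/-- Upper bounds with exponents `e + ε` for all `ε > 0` combine to one with exponent
`e + o(1)`. -/
lemma exists_tendsto_zero_of_eventually_lt {f : ℕ → ℕ} {e : ℝ} (he : 0 ≤ e)
    (h : ∀ ε : ℝ, 0 < ε → ∀ᶠ n : ℕ in atTop, (f n : ℝ) < (n : ℝ) ^ (e + ε)) :
    ∃ o : ℕ → ℝ, Tendsto o atTop (𝓝 0) ∧
      ∀ n : ℕ, 2 ≤ n → (f n : ℝ) < (n : ℝ) ^ (e + o n) := by
  set g : ℕ → ℝ := fun n => max 0 (Real.logb n (f n) - e) with hg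
  -- The positive null term makes the inequality strict for every n ≥ 2, not only for large n.
  refine ⟨fun n => g n + 1 / ((n : ℝ) + 1), ?_, ?_⟩
  · rw [← add_zero (0 : ℝ)]
    refine Tendsto.add ?_ tendsto_one_div_add_atTop_nhds_zero_nat
    rw [tendsto_order]
    refine ⟨fun a ha => Eventually.of_forall fun n => ha.trans_le (le_max_left _ _), ?_⟩
    intro a ha
    filter_upwards [h (a / 2) (by positivity), eventually_ge_atTop 2] with n hn hn2
    have hn1 : (1 : ℝ) < n := by exact_mod_cast hn2
    refine max_lt ha ?_
    rcases Nat.eq_zero_or_pos (f n) with h0 | h0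
    · rw [h0, Nat.cast_zero, Real.logb_zero]
      linarith
    · have : Real.logb n (f n) < e + a / 2 :=
        (Real.logb_lt_iff_lt_rpow hn1 (by exact_mod_cast h0)).2 hn
      linarith
  · intro n hn2
    have hn1 : (1 : ℝ) < n := by exact_mod_cast hn2
    have hpos : (0 : ℝ) < 1 / ((n : ℝ) + 1) := by positivity
    rcases Nat.eq_zero_or_pos (f n) with h0 | h0
    · rw [h0, Nat.cast_zero]
      positivity
    · rw [← Real.logb_lt_iff_lt_rpow hn1 (by exact_mod_cast h0)]
      have := le_max_right 0 (Real.logb n (f n) - e)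
      simp only [hg]
      linarith

end ZeroOneMatrix

theorem theorem1 (t : ℕ) (ht : 2 ≤ t) (r s : ℕ) (A : ZeroOneMatrix r s)
    (hA : ZeroOneMatrix.IsColumnPartite t A) :
    ∃ o : ℕ → ℝ, Tendsto o atTop (𝓝 0) ∧
      ∀ n : ℕ, 2 ≤ n →
        (ZeroOneMatrix.ex n A : ℝ) <
          (n : ℝ) ^ (2 - 1 / (t : ℝ) + 1 / (2 * (t : ℝ) ^ 2) + o n) := by
  refine ZeroOneMatrix.exists_tendsto_zero_of_eventually_lt ?_ fun _ hε =>
    ZeroOneMatrix.eventually_ex_lt ht A hA hε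
  have h1 : 1 / (t : ℝ) ≤ 1 :=
    (div_le_one (by positivity)).2 (by exact_mod_cast (by omega : 1 ≤ t))
  have h2 : 0 ≤ 1 / (2 * (t : ℝ) ^ 2) := by positivity
  linarith
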